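/- Let $n,d\ge 0$ be integers, $T>0$, $\alpha>0$, let $f(x,m,v)\in\mathbb R$, $g(x,m,v)\in\mathbb R^n$, $\sigma(x)\in\mathbb R^{n\times n}$, $h(x,m)\in\mathbb R$ be functions of $x\in\mathbb R^n$, $m\in L^2(\mathbb R^n)$, $v\in\mathbb R^d$, and let $m_0\in L^2(\mathbb R^n)$ be a probability density. Put $a=\sigma\sigma^*$, $A\phi=-\frac12\sum_{i,j}a_{ij}\,\partial^2\phi/\partial x_i\partial x_j$, $$\tilde H(x,m,q,\rho)=\inf_{v}\{q\cdot g(x,m,v)+\rho f(x,m,v)\},$$ let $v^*(x,m,q,\rho)$ denote a minimizer, and put $\tilde F(x,m,q,\rho)=f(x,m,v^*(x,m,q,\rho))$, $\tilde G(x,m,q,\rho)=g(x,m,v^*(x,m,q,\rho))$. Write $\partial\Phi/\partial m(m)(\cdot)\in L^2(\mathbb R^n)$ for the Gateaux derivative of $\Phi:L^2(\mathbb R^n)\to\mathbb R$. Let $(u,\mu,m)$ solve the risk-sensitive adjoint system on $[0,T]$: $$u(x,z,T)=e^{\alpha[z+h(x,m(T))]}+\alpha\int e^{\alpha[\zeta+h(\xi,m(T))]}\,\frac{\partial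 h}{\partial m}(\xi,m(T))(x)\,\mu(d\xi,d\zeta,T),$$ $$-\frac{\partial u}{\partial t}+Au=\tilde H\Big(x,m,D_xu,\frac{\partial u}{\partial z}\Big)+\int\frac{\partial\tilde H}{\partial m}\Big(\xi,m,D_xu(\xi,\zeta,t),\frac{\partial u}{\partial z}(\xi,\zeta,t)\Big)(x)\,\mu(d\xi,d\zeta,t),\qquad 0<t<T,$$ $$\frac{\partial\mu}{\partial t}+A^*\mu+\mathrm{div}_x\Big(\tilde G\Big(x,m,D_xu,\frac{\partial u}{\partial z}\Big)\mu\Big)+\frac{\partial}{\partial z}\Big(\tilde F\Big(x,m,D_xu,\frac{\partial u}{\partial z}\Big)\mu\Big)=0,\qquad \mu(0)=m_0\otimes\delta_0,$$ where $\mu(t)$ is a probability measure on $\mathbb R^n\times\mathbb R$ whose marginal on $\mathbb R^n$ has the density $m(t)\in L^2(\mathbb R^n)$, the equation for $\mu$ holds in the weak sense (tested against $C_c^\infty(\mathbb R^n\times\mathbb R)$), all the integrals and Gateaux derivatives above exist, and at $q=D_xu$, $\rho=\partial u/\partial z$ the Hamiltonian $\tilde H(x,\cdot,q,\rho)$ is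 finite on $L^2(\mathbb R^n)$ and the infimum at $m(t)$ is attained at $v^*$. Assume that $u$ is of class $C^3$ on $\mathbb R^n\times\mathbb R\times(0,T)$ and that $u$ and $\chi:=\partial u/\partial z$ are continuous on $\mathbb R^n\times\mathbb R\times[0,T]$. Assume also that there are constants $K,C,c$ such that (i) $|\sigma_{ij}(x)|\le K$ for all $x,i,j$; (ii) $x\cdot\tilde G+\dfrac{z}{\sqrt{1+z^2}}\,\tilde F\le K(1+|x|^2+|z|)$ on $\mathbb R^n\times\mathbb R\times(0,T)$, with $\tilde F,\tilde G$ evaluated at $(x,m(t),D_xu(x,z,t),\frac{\partial u}{\partial z}(x,z,t))$; (iii) $\chi(x,z,t)\ge -C e^{c(|x|^2+|z|)}$ on $\mathbb R^n\times\mathbb R\times[0,T]$. Then $\chi$ solves $$\chi(x,z,T)=\alpha e^{\alpha[z+h(x,m(T))]},\qquad -\frac{\partial\chi}{\partial t}+A\chi=\frac{\partial\chi}{\partial z}\,\tilde F\Big(x,m,D_xu,\frac{\partial u}{\partial z}\Big)+D_x\chi\cdot\tilde G\Big(x,m,D_xu,\frac{\partial u}{\partial z}\Big)\quad(0<t<T),$$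 and $\chi(x,z,t)>0$ for all $(x,z,t)\in\mathbb R^n\times\mathbb R\times[0,T]$. -/

import Mathlib

open MeasureTheory Set
open scoped ContDiff

namespace RiskSensitive

/-- The state space `ℝⁿ` with its Euclidean norm. -/
abbrev E (n : ℕ) : Type := EuclideanSpace ℝ (Fin n)

/-- The space `L²(ℝⁿ)` in which the densities live. -/
abbrev L2 (n : ℕ) : Type := Lp ℝ 2 (volume : Measure (E n))

/-- The data of the control problem: running cost `f`, drift `g`, diffusion coefficient `σ`,
terminal cost `h`, risk-sensitivity index `α`, horizon `T`, initial density `m₀`. -/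
structure Model (n d : ℕ) where
  f : E n → L2 n → E d → ℝ
  g : E n → L2 n → E d → E n
  σ : E n → Matrix (Fin n) (Fin n) ℝ
  h : E n → L2 n → ℝ
  α : ℝ
  T : ℝ
  m₀ : L2 n

noncomputable section

/-- `m ∈ L²(ℝⁿ)` is a probability density. -/
def IsProbDensity {n : ℕ} (m : L2 n) : Prop :=
  (∀ᵐ x, 0 ≤ m x) ∧ ∫⁻ x, ENNReal.ofReal (m x) = 1

/-- The measure `m(x) dx`. -/
def densityMeasure {n : ℕ} (m : L2 n) : Measure (E n) :=
  volume.withDensity fun x => ENNReal.ofReal (m x)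

/-- `∂φ/∂xᵢ`. -/
def partialX {n : ℕ} (i : Fin n) (φ : E n → ℝ) (x : E n) : ℝ :=
  lineDeriv ℝ φ x (EuclideanSpace.single i 1)

/-- The Gateaux derivative of `Φ : L²(ℝⁿ) → ℝ` at `m` is represented by `k ∈ L²(ℝⁿ)`. -/
def HasGateauxGradient {n : ℕ} (Φ : L2 n → ℝ) (m : L2 n) (k : E n → ℝ) : Prop :=
  MemLp k 2 volume ∧
    ∀ w : L2 n, HasDerivAt (fun θ : ℝ => Φ (m + θ • w)) (∫ ξ, k ξ * w ξ) 0

namespace Model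

variable {n d : ℕ}

/-- `a = σ σ*`. -/
def a (P : Model n d) (x : E n) : Matrix (Fin n) (Fin n) ℝ :=
  P.σ x * (P.σ x).transpose

/-- `Aφ = -½ ∑ aᵢⱼ ∂²φ/∂xᵢ∂xⱼ`. -/
def A (P : Model n d) (φ : E n → ℝ) (x : E n) : ℝ :=
  -(1 / 2) * ∑ i, ∑ j, P.a x i j * partialX i (partialX j φ) x

/-- `q · g(x,m,v) + ρ f(x,m,v)`. -/
def preHam (P : Model n d) (x : E n) (m : L2 n) (q : E n) (ρ : ℝ) (v : E d) : ℝ :=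
  inner ℝ q (P.g x m v) + ρ * P.f x m v

/-- The Hamiltonian of the augmented state, `H̃(x,m,q,ρ) = inf_v { q · g + ρ f }`. -/
def Htilde (P : Model n d) (x : E n) (m : L2 n) (q : E n) (ρ : ℝ) : ℝ :=
  ⨅ v, P.preHam x m q ρ v

/-- `F̃(x,m,q,ρ) = f(x,m,v*(x,m,q,ρ))`. -/
def Ftilde (P : Model n d) (vstar : E n → L2 n → E n → ℝ → E d)
    (x : E n) (m : L2 n) (q : E n) (ρ : ℝ) : ℝ :=
  P.f x m (vstar x m q ρ)

/-- `G̃(x,m,q,ρ) = g(x,m,v*(x,m,q,ρ))`. -/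
def Gtilde (P : Model n d) (vstar : E n → L2 n → E n → ℝ → E d)
    (x : E n) (m : L2 n) (q : E n) (ρ : ℝ) : E n :=
  P.g x m (vstar x m q ρ)

end Model

/-- `D_x u(x,z,t)`. -/
def Dx {n : ℕ} (u : E n → ℝ → ℝ → ℝ) (x : E n) (z t : ℝ) : E n :=
  gradient (fun y => u y z t) x

/-- `∂u/∂z (x,z,t)`. -/
def Dz {n : ℕ} (u : E n → ℝ → ℝ → ℝ) (x : E n) (z t : ℝ) : ℝ :=
  deriv (fun ζ => u x ζ t) z

/-- `∂u/∂t (x,z,t)`. -/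
def Dt {n : ℕ} (u : E n → ℝ → ℝ → ℝ) (x : E n) (z t : ℝ) : ℝ :=
  deriv (fun s => u x z s) t

variable {n d : ℕ}

/-- `F̃(x, m(t), D_x u, ∂u/∂z)` at `(x,z,t)`. -/
def Model.loopF (P : Model n d) (vstar : E n → L2 n → E n → ℝ → E d)
    (u : E n → ℝ → ℝ → ℝ) (m : ℝ → L2 n) (x : E n) (z t : ℝ) : ℝ :=
  P.Ftilde vstar x (m t) (Dx u x z t) (Dz u x z t)

/-- `G̃(x, m(t), D_x u, ∂u/∂z)` at `(x,z,t)`. -/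
def Model.loopG (P : Model n d) (vstar : E n → L2 n → E n → ℝ → E d)
    (u : E n → ℝ → ℝ → ℝ) (m : ℝ → L2 n) (x : E n) (z t : ℝ) : E n :=
  P.Gtilde vstar x (m t) (Dx u x z t) (Dz u x z t)

/-- The generator of the state `(x,z)` under the optimal feedback, at time `t`, applied to a
test function `φ(x,z)`: `-Aφ + G̃ · D_xφ + F̃ ∂φ/∂z`. -/
def Model.generator (P : Model n d) (vstar : E n → L2 n → E n → ℝ → E d)
    (u : E n → ℝ → ℝ → ℝ) (m : ℝ → L2 n) (t : ℝ) (φ : E n × ℝ → ℝ) (p : E n × ℝ) : ℝ :=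
  -P.A (fun y => φ (y, p.2)) p.1
    + inner ℝ (gradient (fun y => φ (y, p.2)) p.1) (P.loopG vstar u m p.1 p.2 t)
    + deriv (fun ζ => φ (p.1, ζ)) p.2 * P.loopF vstar u m p.1 p.2 t

/-- `(u, μ, m)` is a solution of the risk-sensitive adjoint system: `u` is a classical solution
of the backward equation (of class `C³` inside the slab, with `u` and `∂u/∂z` continuous up to
the boundary `t = 0, T`), `μ` is a weak solution of the degenerate Fokker-Planck equation with
the optimal feedback, and `m(t)` is the density of the first marginal of `μ(t)`.
The functions `dh ξ m` and `dH ξ m q ρ` represent the Gateaux derivatives in `m` of `h(ξ, m)`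
and `H̃(ξ, m, q, ρ)`. -/
structure IsAdjointSolution (P : Model n d) (vstar : E n → L2 n → E n → ℝ → E d)
    (dh : E n → L2 n → E n → ℝ) (dH : E n → L2 n → E n → ℝ → E n → ℝ)
    (u : E n → ℝ → ℝ → ℝ) (μ : ℝ → Measure (E n × ℝ)) (m : ℝ → L2 n) : Prop where
  u_contDiffOn : ContDiffOn ℝ 3 (fun p : E n × ℝ × ℝ => u p.1 p.2.1 p.2.2)
    (univ ×ˢ univ ×ˢ Ioo 0 P.T)
  u_continuousOn : ContinuousOn (fun p : E n × ℝ × ℝ => u p.1 p.2.1 p.2.2)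
    (univ ×ˢ univ ×ˢ Icc 0 P.T)
  Dz_continuousOn : ContinuousOn (fun p : E n × ℝ × ℝ => Dz u p.1 p.2.1 p.2.2)
    (univ ×ˢ univ ×ˢ Icc 0 P.T)
  /-- Along the solution the infimum that defines `H̃` is finite, for every density argument. -/
  Htilde_finite : ∀ t ∈ Ioo 0 P.T, ∀ x z, ∀ m' : L2 n,
    BddBelow (range (P.preHam x m' (Dx u x z t) (Dz u x z t)))
  /-- Along the solution the infimum is attained at the feedback `v*`. -/
  vstar_optimal : ∀ t ∈ Ioo 0 P.T, ∀ x z,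
    IsMinOn (P.preHam x (m t) (Dx u x z t) (Dz u x z t)) univ
      (vstar x (m t) (Dx u x z t) (Dz u x z t))
  dh_gateaux : ∀ ξ, HasGateauxGradient (fun m' => P.h ξ m') (m P.T) (dh ξ (m P.T))
  dH_gateaux : ∀ t ∈ Ioo 0 P.T, ∀ ξ ζ,
    HasGateauxGradient (fun m' => P.Htilde ξ m' (Dx u ξ ζ t) (Dz u ξ ζ t)) (m t)
      (dH ξ (m t) (Dx u ξ ζ t) (Dz u ξ ζ t))
  terminal_integrable : ∀ x, Integrable
    (fun p : E n × ℝ => Real.exp (P.α * (p.2 + P.h p.1 (m P.T))) * dh p.1 (m P.T) x) (μ P.T)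
  terminal : ∀ x z, u x z P.T = Real.exp (P.α * (z + P.h x (m P.T)))
    + P.α * ∫ p : E n × ℝ, Real.exp (P.α * (p.2 + P.h p.1 (m P.T))) * dh p.1 (m P.T) x ∂μ P.T
  nonlocal_integrable : ∀ t ∈ Ioo 0 P.T, ∀ x, Integrable
    (fun p : E n × ℝ => dH p.1 (m t) (Dx u p.1 p.2 t) (Dz u p.1 p.2 t) x) (μ t)
  backward : ∀ t ∈ Ioo 0 P.T, ∀ x z,
    -Dt u x z t + P.A (fun y => u y z t) x = P.Htilde x (m t) (Dx u x z t) (Dz u x z t)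
      + ∫ p : E n × ℝ, dH p.1 (m t) (Dx u p.1 p.2 t) (Dz u p.1 p.2 t) x ∂μ t
  prob : ∀ t ∈ Icc 0 P.T, IsProbabilityMeasure (μ t)
  density : ∀ t ∈ Icc 0 P.T, IsProbDensity (m t) ∧
    (μ t).map Prod.fst = densityMeasure (m t)
  initial : μ 0 = (densityMeasure P.m₀).prod (Measure.dirac (0 : ℝ))
  fokkerPlanck : ∀ φ : E n × ℝ → ℝ, ContDiff ℝ ∞ φ → HasCompactSupport φ →
    (∀ᵐ s ∂(volume.restrict (Ioo 0 P.T)), Integrable (P.generator vstar u m s φ) (μ s)) ∧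
    IntervalIntegrable (fun s => ∫ p, P.generator vstar u m s φ p ∂μ s) volume 0 P.T ∧
    ∀ t ∈ Icc 0 P.T, ∫ p, φ p ∂μ t =
      ∫ p, φ p ∂μ 0 + ∫ s in (0 : ℝ)..t, ∫ p, P.generator vstar u m s φ p ∂μ s

end

end RiskSensitive

/-!
The nonlocal terms of the backward equation do not depend on `z`. Differentiating it in `z`
therefore removes them, and by the envelope theorem the Hamiltonian only contributes the
derivatives of `D_x u` and `∂u/∂z` weighted by the optimal `G̃` and `F̃`: `χ = ∂u/∂z` solves the
linear backward equation of the closed-loop diffusion, with positive terminal data.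

Positivity follows from a minimum principle on the unbounded state space. With the Lyapunov function
`V = |x|²/2 + √(1 + z²)`, the barrier `κ exp((l + Λ (t₂ - t)) V)` is a strict supersolution while
its exponent stays below `2 l`, so it controls `χ` on a time interval whose length depends only on
the growth of `χ` and on `V`. Positivity is propagated backwards from `T` in finitely many such
steps.
-/

namespace RiskSensitive

open Filter Topology

section LineDeriv

variable {X F : Type*} [NormedAddCommGroup X] [NormedSpace ℝ X] [NormedAddCommGroup F]
  [NormedSpace ℝ F] {φ : X → F} {p : X}

theorem deriv_comp_add_smul (φ : X → F) (p v : X) :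
    deriv (fun r : ℝ => φ (p + r • v)) = fun r => lineDeriv ℝ φ (p + r • v) v := by
  funext r
  have hshift := deriv_comp_add_const (fun r : ℝ => φ (p + r • v)) r 0
  rw [zero_add] at hshift
  simp only [← hshift, lineDeriv, add_smul, add_assoc, add_comm (r • v)]

theorem lineDeriv_eventuallyEq_fderiv (hφ : ContDiffAt ℝ 1 φ p) (v : X) :
    (fun q => lineDeriv ℝ φ q v) =ᶠ[𝓝 p] fun q => fderiv ℝ φ q v :=
  (hφ.eventually (by simp)).mono fun _ hq =>
    (hq.differentiableAt one_ne_zero).lineDeriv_eq_fderiv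

theorem contDiffAt_lineDeriv {k l : WithTop ℕ∞} (hφ : ContDiffAt ℝ l φ p) (hkl : k + 1 ≤ l)
    (v : X) : ContDiffAt ℝ k (fun q => lineDeriv ℝ φ q v) p :=
  ((hφ.fderiv_right hkl).clm_apply contDiffAt_const).congr_of_eventuallyEq
    (lineDeriv_eventuallyEq_fderiv (hφ.of_le (le_add_self.trans hkl)) v)

theorem lineDeriv_lineDeriv_eq_fderiv_fderiv (hφ : ContDiffAt ℝ 2 φ p) (v w : X) :
    lineDeriv ℝ (fun q => lineDeriv ℝ φ q v) p w = fderiv ℝ (fderiv ℝ φ) p w v := by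
  have hd : DifferentiableAt ℝ (fderiv ℝ φ) p :=
    (hφ.fderiv_right (m := 1) (by norm_num)).differentiableAt one_ne_zero
  have hdv := hd.hasFDerivAt.clm_apply (hasFDerivAt_const v p)
  rw [(lineDeriv_eventuallyEq_fderiv (hφ.of_le one_le_two) v).lineDeriv_eq,
    hdv.differentiableAt.lineDeriv_eq_fderiv, hdv.fderiv]
  simp

theorem lineDeriv_comm (hφ : ContDiffAt ℝ 2 φ p) (v w : X) :
    lineDeriv ℝ (fun q => lineDeriv ℝ φ q v) p w
      = lineDeriv ℝ (fun q => lineDeriv ℝ φ q w) p v := by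
  rw [lineDeriv_lineDeriv_eq_fderiv_fderiv hφ, lineDeriv_lineDeriv_eq_fderiv_fderiv hφ]
  exact hφ.isSymmSndFDerivAt (by simp) w v

theorem hasLineDerivAt_lineDeriv (hφ : ContDiffAt ℝ 2 φ p) (v e : X) :
    HasLineDerivAt ℝ (fun q => lineDeriv ℝ φ q v)
      (lineDeriv ℝ (fun q => lineDeriv ℝ φ q e) p v) p e := by
  rw [lineDeriv_comm hφ]
  exact ((contDiffAt_lineDeriv hφ (k := 1) (by norm_num) v).differentiableAt
    one_ne_zero).lineDifferentiableAt.hasLineDerivAt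

theorem hasLineDerivAt_lineDeriv_lineDeriv (hφ : ContDiffAt ℝ 3 φ p) (v w e : X) :
    HasLineDerivAt ℝ (fun q => lineDeriv ℝ (fun r => lineDeriv ℝ φ r v) q w)
      (lineDeriv ℝ (fun q => lineDeriv ℝ (fun r => lineDeriv ℝ φ r e) q v) p w) p e := by
  have hcomm : (fun q => lineDeriv ℝ (fun r => lineDeriv ℝ φ r e) q v)
      =ᶠ[𝓝 p] fun q => lineDeriv ℝ (fun r => lineDeriv ℝ φ r v) q e :=
    (hφ.eventually (by simp)).mono fun _ hq => lineDeriv_comm (hq.of_le (by norm_num)) e v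
  rw [hcomm.lineDeriv_eq]
  exact hasLineDerivAt_lineDeriv (contDiffAt_lineDeriv hφ (by norm_num) v) w e

end LineDeriv

section LocalMinimum

theorem fderiv_fderiv_nonneg_of_isLocalMin {X : Type*} [NormedAddCommGroup X] [NormedSpace ℝ X]
    {φ : X → ℝ} {p : X} (hφ : ContDiffAt ℝ 2 φ p) (hmin : IsLocalMin φ p) (v : X) :
    0 ≤ fderiv ℝ (fderiv ℝ φ) p v v := by
  set f : ℝ → ℝ := fun r => φ (p + r • v)
  have hline : ContinuousAt (fun r : ℝ => p + r • v) 0 := by fun_prop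
  have hp : p + (0 : ℝ) • v = p := by simp
  have hfc : ContinuousAt f 0 := hφ.continuousAt.comp_of_eq hline hp
  have hfmin : IsLocalMin f 0 :=
    IsLocalMin.comp_continuous (g := fun r : ℝ => p + r • v) (by rwa [hp]) hline
  have hsnd : deriv (deriv f) 0 = fderiv ℝ (fderiv ℝ φ) p v v := by
    rw [deriv_comp_add_smul, ← lineDeriv_lineDeriv_eq_fderiv_fderiv hφ, lineDeriv]
  rw [← hsnd]
  by_contra! hneg
  have hfmax := isLocalMax_of_deriv_deriv_neg hneg hfmin.deriv_eq_zero hfc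
  have hconst : f =ᶠ[𝓝 0] fun _ => f 0 := by
    filter_upwards [hfmin, hfmax] with r hle hge using le_antisymm hge hle
  simp [hconst.deriv.deriv_eq] at hneg

theorem deriv_nonneg_of_isMinOn_Icc {f : ℝ → ℝ} {t₁ t₂ : ℝ} (h : t₁ < t₂)
    (hf : DifferentiableAt ℝ f t₁) (hmin : IsMinOn f (Icc t₁ t₂) t₁) : 0 ≤ deriv f t₁ := by
  refine hmin.localize.hasFDerivWithinAt_nonneg hf.hasDerivAt.hasFDerivAt.hasFDerivWithinAt
    (y := 1) ?_ |>.trans_eq (by simp)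
  rw [one_mem_posTangentConeAt_iff_mem_closure]
  have hIoc : Ioc t₁ t₂ ⊆ Ioi t₁ ∩ Icc t₁ t₂ := fun r hr => ⟨hr.1, hr.1.le, hr.2⟩
  exact closure_mono hIoc (by simp [closure_Ioc h.ne, h.le])

theorem hasDerivAt_iInf_eq_of_isMinOn {ι : Type*} {h : ι → ℝ → ℝ} {v₀ : ι} {z h' H' : ℝ}
    (hbdd : ∀ᶠ ζ in 𝓝 z, BddBelow (range fun v => h v ζ))
    (hmin : IsMinOn (fun v => h v z) univ v₀) (hh : HasDerivAt (h v₀) h' z)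
    (hH : HasDerivAt (fun ζ => ⨅ v, h v ζ) H' z) : H' = h' := by
  have : Nonempty ι := ⟨v₀⟩
  have hz : ⨅ v, h v z = h v₀ z :=
    le_antisymm (ciInf_le hbdd.self_of_nhds v₀) (le_ciInf fun v => hmin (mem_univ v))
  have hgap : IsLocalMin (fun ζ => h v₀ ζ - ⨅ v, h v ζ) z := by
    filter_upwards [hbdd] with ζ hζ
    simpa only [hz, sub_self, sub_nonneg] using ciInf_le hζ v₀
  linarith [hgap.hasDerivAt_eq_zero (hh.sub hH)]

end LocalMinimum

section Generator

variable {X ι : Type*} [NormedAddCommGroup X] [NormedSpace ℝ X] [Fintype ι]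

/-- The generator of the diffusion on `X` with drift `b` and noise fields `s k`, the columns of
the diffusion matrix. -/
noncomputable def diffusionGenerator (s : ι → X → X) (b : X → X) (φ : X → ℝ) (p : X) : ℝ :=
  1 / 2 * ∑ k, fderiv ℝ (fderiv ℝ φ) p (s k p) (s k p) + fderiv ℝ φ p (b p)

/-- The carré du champ `L(φ²) - 2 φ Lφ` of the diffusion with noise fields `s k`. -/
noncomputable def carreDuChamp (s : ι → X → X) (φ : X → ℝ) (p : X) : ℝ :=
  ∑ k, fderiv ℝ φ p (s k p) ^ 2

variable {s : ι → X → X} {b : X → X} {φ ψ V : X → ℝ} {p : X}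

theorem carreDuChamp_nonneg (s : ι → X → X) (φ : X → ℝ) (p : X) : 0 ≤ carreDuChamp s φ p :=
  Finset.sum_nonneg fun _ _ => sq_nonneg _

theorem diffusionGenerator_add (hφ : ContDiff ℝ 2 φ) (hψ : ContDiff ℝ 2 ψ) :
    diffusionGenerator s b (fun q => φ q + ψ q) p
      = diffusionGenerator s b φ p + diffusionGenerator s b ψ p := by
  have hfst : fderiv ℝ (fun q => φ q + ψ q) = fun q => fderiv ℝ φ q + fderiv ℝ ψ q :=
    funext fun q => fderiv_fun_add (hφ.differentiable two_ne_zero q)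
      (hψ.differentiable two_ne_zero q)
  have hsnd := fderiv_fun_add
    ((hφ.fderiv_right (m := 1) (by norm_num)).differentiable one_ne_zero p)
    ((hψ.fderiv_right (m := 1) (by norm_num)).differentiable one_ne_zero p)
  simp only [diffusionGenerator, hfst, hsnd, add_apply, Finset.sum_add_distrib]
  ring

theorem diffusionGenerator_const (c : ℝ) : diffusionGenerator s b (fun _ => c) p = 0 := by
  simp [diffusionGenerator]

theorem diffusionGenerator_nonneg_of_isLocalMin (hφ : ContDiff ℝ 2 φ) (hmin : IsLocalMin φ p) :
    0 ≤ diffusionGenerator s b φ p := by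
  rw [diffusionGenerator, hmin.fderiv_eq_zero, zero_apply, add_zero]
  exact mul_nonneg one_half_pos.le (Finset.sum_nonneg fun k _ =>
    fderiv_fderiv_nonneg_of_isLocalMin hφ.contDiffAt hmin (s k p))

theorem diffusionGenerator_const_mul_exp (hV : ContDiff ℝ 2 V) (κ l : ℝ) :
    diffusionGenerator s b (fun q => κ * Real.exp (l * V q)) p
      = κ * Real.exp (l * V p)
        * (l * diffusionGenerator s b V p + l ^ 2 / 2 * carreDuChamp s V p) := by
  have hexp : ∀ q, HasFDerivAt (fun q => κ * Real.exp (l * V q))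
      ((κ * Real.exp (l * V q) * l) • fderiv ℝ V q) q := fun q => by
    have hVq := (hV.differentiable two_ne_zero q).hasFDerivAt
    refine ((hVq.const_mul l).exp.const_mul κ).congr_fderiv ?_
    simp only [smul_smul, mul_assoc]
  have hfst : fderiv ℝ (fun q => κ * Real.exp (l * V q))
      = fun q => (κ * Real.exp (l * V q) * l) • fderiv ℝ V q := funext fun q => (hexp q).fderiv
  have hdV := ((hV.fderiv_right (m := 1) (by norm_num)).differentiable one_ne_zero p).hasFDerivAt
  have hsnd := (((hexp p).mul_const l).fun_smul hdV).fderiv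
  have hquad : ∀ w, fderiv ℝ (fderiv ℝ fun q => κ * Real.exp (l * V q)) p w w
      = κ * Real.exp (l * V p)
        * (l * fderiv ℝ (fderiv ℝ V) p w w + l ^ 2 * fderiv ℝ V p w ^ 2) := by
    intro w
    rw [hfst, hsnd]
    simp only [add_apply, smul_apply, ContinuousLinearMap.smulRight_apply, smul_eq_mul]
    ring
  simp only [diffusionGenerator, carreDuChamp, hquad, (hexp p).fderiv, smul_apply, smul_eq_mul,
    ← Finset.mul_sum, Finset.sum_add_distrib]
  ring

end Generator

section MinimumPrinciple

variable {X ι : Type*} [NormedAddCommGroup X] [NormedSpace ℝ X] [Fintype ι]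
  {s : ℝ → ι → X → X} {b : ℝ → X → X} {t₁ t₂ r₁ r₂ : ℝ} {φ ψ χ : ℝ → X → ℝ}

/-- The backward Kolmogorov operator `∂φ/∂t + L_t φ` of the time-dependent diffusion with drift
`b t` and noise fields `s t k`. -/
noncomputable def backwardOperator (s : ℝ → ι → X → X) (b : ℝ → X → X) (φ : ℝ → X → ℝ)
    (t : ℝ) (p : X) : ℝ :=
  deriv (fun r => φ r p) t + diffusionGenerator (s t) (b t) (φ t) p

/-- The regularity of a classical solution of a parabolic equation on `[t₁, t₂] × X`: continuity
up to the boundary, and the derivatives that the equation involves inside. -/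
structure IsClassical (t₁ t₂ : ℝ) (φ : ℝ → X → ℝ) : Prop where
  continuousOn : ContinuousOn (Function.uncurry φ) (Icc t₁ t₂ ×ˢ univ)
  differentiableAt : ∀ t ∈ Ioo t₁ t₂, ∀ p, DifferentiableAt ℝ (fun r => φ r p) t
  contDiff : ∀ t ∈ Ioo t₁ t₂, ContDiff ℝ 2 (φ t)

theorem IsClassical.mono (hφ : IsClassical t₁ t₂ φ) (h₁ : t₁ ≤ r₁) (h₂ : r₂ ≤ t₂) :
    IsClassical r₁ r₂ φ where
  continuousOn := hφ.continuousOn.mono (prod_mono_left (Icc_subset_Icc h₁ h₂))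
  differentiableAt t ht := hφ.differentiableAt t (Ioo_subset_Ioo h₁ h₂ ht)
  contDiff t ht := hφ.contDiff t (Ioo_subset_Ioo h₁ h₂ ht)

theorem IsClassical.const (t₁ t₂ c : ℝ) : IsClassical t₁ t₂ fun _ (_ : X) => c where
  continuousOn := continuousOn_const
  differentiableAt _ _ _ := differentiableAt_const c
  contDiff _ _ := contDiff_const

theorem IsClassical.add (hφ : IsClassical t₁ t₂ φ) (hψ : IsClassical t₁ t₂ ψ) :
    IsClassical t₁ t₂ fun t p => φ t p + ψ t p where
  continuousOn := hφ.continuousOn.add hψ.continuousOn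
  differentiableAt t ht p := (hφ.differentiableAt t ht p).add (hψ.differentiableAt t ht p)
  contDiff t ht := (hφ.contDiff t ht).add (hψ.contDiff t ht)

theorem IsClassical.continuous_apply (hφ : IsClassical t₁ t₂ φ) {t : ℝ} (ht : t ∈ Icc t₁ t₂) :
    Continuous (φ t) :=
  continuousOn_univ.1 <| hφ.continuousOn.comp (f := fun p => (t, p)) (by fun_prop)
    fun _ _ => ⟨ht, mem_univ _⟩

theorem backwardOperator_add (hφ : IsClassical t₁ t₂ φ) (hψ : IsClassical t₁ t₂ ψ) {t : ℝ}
    (ht : t ∈ Ioo t₁ t₂) (p : X) :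
    backwardOperator s b (fun t p => φ t p + ψ t p) t p
      = backwardOperator s b φ t p + backwardOperator s b ψ t p := by
  rw [backwardOperator, deriv_fun_add (hφ.differentiableAt t ht p) (hψ.differentiableAt t ht p),
    diffusionGenerator_add (hφ.contDiff t ht) (hψ.contDiff t ht), backwardOperator,
    backwardOperator]
  ring

theorem backwardOperator_const (c t : ℝ) (p : X) :
    backwardOperator s b (fun _ _ => c) t p = 0 := by
  rw [backwardOperator, deriv_const, diffusionGenerator_const, add_zero]

/-- A classical supersolution of the backward equation of the diffusion on `[t₁, t₂] × X`. -/
structure IsBackwardSupersolution (s : ℝ → ι → X → X) (b : ℝ → X → X) (t₁ t₂ : ℝ)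
    (χ : ℝ → X → ℝ) : Prop extends IsClassical t₁ t₂ χ where
  backwardOperator_nonpos : ∀ t ∈ Ioo t₁ t₂, ∀ p, backwardOperator s b χ t p ≤ 0

theorem IsBackwardSupersolution.mono (hχ : IsBackwardSupersolution s b t₁ t₂ χ) (h₁ : t₁ ≤ r₁)
    (h₂ : r₂ ≤ t₂) : IsBackwardSupersolution s b r₁ r₂ χ where
  toIsClassical := hχ.toIsClassical.mono h₁ h₂
  backwardOperator_nonpos t ht := hχ.backwardOperator_nonpos t (Ioo_subset_Ioo h₁ h₂ ht)

theorem IsBackwardSupersolution.add_const (hχ : IsBackwardSupersolution s b t₁ t₂ χ) (c : ℝ) :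
    IsBackwardSupersolution s b t₁ t₂ fun t p => χ t p + c where
  toIsClassical := hχ.toIsClassical.add (.const t₁ t₂ c)
  backwardOperator_nonpos t ht p := by
    rw [backwardOperator_add hχ.toIsClassical (.const t₁ t₂ c) ht, backwardOperator_const, add_zero]
    exact hχ.backwardOperator_nonpos t ht p

theorem IsClassical.nonneg_of_backwardOperator_neg (hψ : IsClassical t₁ t₂ ψ) (h : t₁ < t₂)
    (hneg : ∀ t ∈ Ioo t₁ t₂, ∀ p, backwardOperator s b ψ t p < 0) {K : Set X} (hK : IsCompact K)
    (hout : ∀ t ∈ Icc t₁ t₂, ∀ p ∉ K, 0 ≤ ψ t p) (hend : ∀ p, 0 ≤ ψ t₂ p) {t : ℝ}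
    (ht : t ∈ Icc t₁ t₂) (p : X) : 0 ≤ ψ t p := by
  suffices hIoc : ∀ t ∈ Ioc t₁ t₂, 0 ≤ ψ t p by
    have hline : ContinuousOn (fun r => ψ r p) (Icc t₁ t₂) :=
      hψ.continuousOn.comp (f := fun r => (r, p)) (by fun_prop) fun _ hr => ⟨hr, mem_univ _⟩
    rw [← closure_Ioc h.ne] at hline ht
    exact le_on_closure hIoc continuousOn_const hline ht
  clear! t
  intro t ht
  by_contra! hlt
  have hsub : Icc t t₂ ⊆ Icc t₁ t₂ := Icc_subset_Icc_left ht.1.le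
  have hmem : ∀ r ∈ Icc t t₂, ∀ q, ψ r q < 0 → (r, q) ∈ Icc t t₂ ×ˢ K := fun r hr q hrq =>
    ⟨hr, by_contra fun hq => (hout r (hsub hr) q hq).not_gt hrq⟩
  have htp := hmem t (left_mem_Icc.2 ht.2) p hlt
  obtain ⟨⟨t₀, p₀⟩, ⟨ht₀, -⟩, hmin⟩ := (isCompact_Icc.prod hK).exists_isMinOn ⟨_, htp⟩
    (hψ.continuousOn.mono (prod_mono hsub (subset_univ K)))
  have hneg₀ : ψ t₀ p₀ < 0 := (hmin htp).trans_lt hlt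
  have hmin' : ∀ r ∈ Icc t t₂, ∀ q, ψ t₀ p₀ ≤ ψ r q := fun r hr q =>
    (lt_or_ge (ψ r q) 0).elim (fun hrq => hmin (hmem r hr q hrq)) hneg₀.le.trans
  have ht₀₂ : t₀ < t₂ := ht₀.2.lt_of_ne (by rintro rfl; exact (hend p₀).not_gt hneg₀)
  have ht₀' : t₀ ∈ Ioo t₁ t₂ := ⟨ht.1.trans_le ht₀.1, ht₀₂⟩
  have htime : 0 ≤ deriv (fun r => ψ r p₀) t₀ :=
    deriv_nonneg_of_isMinOn_Icc ht₀₂ (hψ.differentiableAt t₀ ht₀' p₀)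
      fun r hr => hmin' r ⟨ht₀.1.trans hr.1, hr.2⟩ p₀
  have hspace : 0 ≤ diffusionGenerator (s t₀) (b t₀) (ψ t₀) p₀ :=
    diffusionGenerator_nonneg_of_isLocalMin (hψ.contDiff t₀ ht₀')
      (Eventually.of_forall (hmin' t₀ ht₀))
  exact (hneg t₀ ht₀' p₀).not_ge (add_nonneg htime hspace)

end MinimumPrinciple

section Barrier

variable {X ι : Type*} [NormedAddCommGroup X] [NormedSpace ℝ X] [Fintype ι]
  {s : ℝ → ι → X → X} {b : ℝ → X → X} {t₁ t₂ r₁ r₂ M : ℝ} {χ : ℝ → X → ℝ} {V : X → ℝ}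

/-- A Lyapunov function controlling the diffusion on the time interval `(t₁, t₂)`. The bound on the
carré du champ makes exponentials of `V` usable as barriers. -/
structure IsLyapunov (s : ℝ → ι → X → X) (b : ℝ → X → X) (t₁ t₂ M : ℝ) (V : X → ℝ) :
    Prop where
  contDiff : ContDiff ℝ 2 V
  one_le : ∀ p, 1 ≤ V p
  isCompact_le : ∀ R, IsCompact {p | V p ≤ R}
  generator_le : ∀ t ∈ Ioo t₁ t₂, ∀ p, diffusionGenerator (s t) (b t) V p ≤ M * V p
  carreDuChamp_le : ∀ t ∈ Ioo t₁ t₂, ∀ p, carreDuChamp (s t) V p ≤ M * V p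

theorem IsLyapunov.mono (hV : IsLyapunov s b t₁ t₂ M V) (h₁ : t₁ ≤ r₁) (h₂ : r₂ ≤ t₂) :
    IsLyapunov s b r₁ r₂ M V where
  __ := hV
  generator_le t ht := hV.generator_le t (Ioo_subset_Ioo h₁ h₂ ht)
  carreDuChamp_le t ht := hV.carreDuChamp_le t (Ioo_subset_Ioo h₁ h₂ ht)

/-- The Tychonoff barrier `κ exp((l + Λ (t₂ - t)) V)`, whose exponent grows backwards in time from
the value `l` at `t₂`. -/
noncomputable def barrier {Y : Type*} (V : Y → ℝ) (κ l Λ t₂ t : ℝ) (p : Y) : ℝ :=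
  κ * Real.exp ((l + Λ * (t₂ - t)) * V p)

theorem hasDerivAt_barrier {Y : Type*} (V : Y → ℝ) (κ l Λ t₂ t : ℝ) (p : Y) :
    HasDerivAt (fun r => barrier V κ l Λ t₂ r p) (-(barrier V κ l Λ t₂ t p * (Λ * V p))) t := by
  have hexponent := ((((hasDerivAt_id t).const_sub t₂).const_mul Λ).const_add l).mul_const (V p)
  refine (hexponent.exp.const_mul κ).congr_deriv ?_
  simp only [barrier, id_eq]
  ring

theorem isClassical_barrier (hV : ContDiff ℝ 2 V) (κ l Λ t₁ t₂ : ℝ) :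
    IsClassical t₁ t₂ (barrier V κ l Λ t₂) where
  continuousOn := by
    have := hV.continuous
    unfold Function.uncurry barrier
    fun_prop
  differentiableAt t _ p := (hasDerivAt_barrier V κ l Λ t₂ t p).differentiableAt
  contDiff _ _ := contDiff_const.mul (contDiff_const.mul hV).exp

theorem IsLyapunov.backwardOperator_barrier_neg (hV : IsLyapunov s b t₁ t₂ M V) {κ l Λ t : ℝ}
    (hκ : 0 < κ) (ht : t ∈ Ioo t₁ t₂) (hl : 0 ≤ l + Λ * (t₂ - t))
    (hl' : l + Λ * (t₂ - t) ≤ 2 * l) (hΛ : M * (2 * l + 2 * l ^ 2) < Λ) (p : X) :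
    backwardOperator s b (barrier V κ l Λ t₂) t p < 0 := by
  have hV₀ : 0 < V p := one_pos.trans_le (hV.one_le p)
  have hM : 0 ≤ M := nonneg_of_mul_nonneg_left
    ((carreDuChamp_nonneg (s t) V p).trans (hV.carreDuChamp_le t ht p)) hV₀
  have hgen := diffusionGenerator_const_mul_exp (s := s t) (b := b t) (p := p) hV.contDiff κ
    (l + Λ * (t₂ - t))
  rw [backwardOperator, (hasDerivAt_barrier V κ l Λ t₂ t p).deriv]
  unfold barrier
  rw [hgen]
  set r := l + Λ * (t₂ - t)
  have hgrow : r * diffusionGenerator (s t) (b t) V p + r ^ 2 / 2 * carreDuChamp (s t) V p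
      < Λ * V p :=
    calc r * diffusionGenerator (s t) (b t) V p + r ^ 2 / 2 * carreDuChamp (s t) V p
        ≤ r * (M * V p) + r ^ 2 / 2 * (M * V p) := by
          gcongr
          exacts [hV.generator_le t ht p, hV.carreDuChamp_le t ht p]
      _ = M * (r + r ^ 2 / 2) * V p := by ring
      _ ≤ M * (2 * l + (2 * l) ^ 2 / 2) * V p := by gcongr
      _ = M * (2 * l + 2 * l ^ 2) * V p := by ring
      _ < Λ * V p := by gcongr
  have := mul_lt_mul_of_pos_left hgrow (mul_pos hκ (Real.exp_pos (r * V p)))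
  linarith

theorem IsBackwardSupersolution.add_barrier_nonneg (hχ : IsBackwardSupersolution s b t₁ t₂ χ)
    (hV : IsLyapunov s b t₁ t₂ M V) {C c κ Λ : ℝ} (hc : 0 ≤ c)
    (hgrowth : ∀ t ∈ Icc t₁ t₂, ∀ p, -(C * Real.exp (c * V p)) ≤ χ t p)
    (h : t₁ < t₂) (hκ : 0 < κ) (hΛ₀ : 0 ≤ Λ) (hΛ : M * (2 * (c + 1) + 2 * (c + 1) ^ 2) < Λ)
    (hstep : Λ * (t₂ - t₁) ≤ c + 1) (hend : ∀ p, 0 ≤ χ t₂ p + κ * Real.exp ((c + 1) * V p))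
    {t : ℝ} (ht : t ∈ Icc t₁ t₂) (p : X) : 0 ≤ χ t p + barrier V κ (c + 1) Λ t₂ t p := by
  have hl : ∀ r ∈ Icc t₁ t₂, 0 ≤ Λ * (t₂ - r) ∧ Λ * (t₂ - r) ≤ c + 1 := fun r hr =>
    ⟨mul_nonneg hΛ₀ (sub_nonneg.2 hr.2),
      (mul_le_mul_of_nonneg_left (sub_le_sub_left hr.1 t₂) hΛ₀).trans hstep⟩
  have hbarrier := isClassical_barrier hV.contDiff κ (c + 1) Λ t₁ t₂
  refine (hχ.toIsClassical.add hbarrier).nonneg_of_backwardOperator_neg (s := s) (b := b) h ?_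
    (hV.isCompact_le (C / κ)) ?_ (fun q => by simpa [barrier] using hend q) ht p
  · intro r hr q
    obtain ⟨hl₀, hl₁⟩ := hl r (Ioo_subset_Icc_self hr)
    rw [backwardOperator_add hχ.toIsClassical hbarrier hr]
    exact add_neg_of_nonpos_of_neg (hχ.backwardOperator_nonpos r hr q)
      (hV.backwardOperator_barrier_neg hκ hr (by linarith) (by linarith) hΛ q)
  · intro r hr q hq
    have hVq : C ≤ κ * V q := ((div_lt_iff₀' hκ).1 (not_le.1 hq)).le
    have hdom : C * Real.exp (c * V q) ≤ barrier V κ (c + 1) Λ t₂ r q :=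
      calc C * Real.exp (c * V q) ≤ κ * V q * Real.exp (c * V q) := by gcongr
        _ ≤ κ * Real.exp (V q) * Real.exp (c * V q) := by
          gcongr
          linarith [Real.add_one_le_exp (V q)]
        _ = κ * Real.exp ((c + 1) * V q) := by
          rw [mul_assoc, ← Real.exp_add]
          ring_nf
        _ ≤ barrier V κ (c + 1) Λ t₂ r q := by
          unfold barrier
          gcongr ?_ * Real.exp (?_ * _)
          · exact zero_le_one.trans (hV.one_le q)
          · exact le_add_of_nonneg_right (hl r hr).1
    linarith [hgrowth r hr q]

theorem IsBackwardSupersolution.pos_of_short (hχ : IsBackwardSupersolution s b t₁ t₂ χ)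
    (hV : IsLyapunov s b t₁ t₂ M V) {C c Λ : ℝ} (hc : 0 ≤ c)
    (hgrowth : ∀ t ∈ Icc t₁ t₂, ∀ p, -(C * Real.exp (c * V p)) ≤ χ t p)
    (h : t₁ < t₂) (hΛ₀ : 0 ≤ Λ) (hΛ : M * (2 * (c + 1) + 2 * (c + 1) ^ 2) < Λ)
    (hstep : Λ * (t₂ - t₁) ≤ c + 1) (hend : ∀ p, 0 < χ t₂ p) (p : X) : 0 < χ t₁ p := by
  have hV₀ : ∀ q, 0 ≤ V q := fun q => zero_le_one.trans (hV.one_le q)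
  -- The exponent at most doubles on the way back to `t₁`, so a barrier that reaches `η` on
  -- `{V = R}` at time `t₂` is still below `η` at `(t₁, p)` as soon as `R > 2 V p`.
  set R := 2 * V p + 1
  obtain ⟨q₀, -, hq₀⟩ := (hV.isCompact_le R).exists_isMinOn
    ⟨p, (by simp only [R]; linarith [hV₀ p] : V p ≤ R)⟩
    (hχ.continuous_apply (right_mem_Icc.2 h.le)).continuousOn
  set η := χ t₂ q₀
  have hη : 0 < η := hend q₀
  set κ := η / Real.exp ((c + 1) * R)
  have hκ : 0 < κ := by positivity
  have hκR : κ * Real.exp ((c + 1) * R) = η := div_mul_cancel₀ _ (Real.exp_ne_zero _)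
  have hgrowth' : ∀ t ∈ Icc t₁ t₂, ∀ q, -((C + η) * Real.exp (c * V q)) ≤ χ t q + -η := by
    intro t ht q
    have hexp : 1 ≤ Real.exp (c * V q) := Real.one_le_exp (mul_nonneg hc (hV₀ q))
    linarith [hgrowth t ht q, mul_le_mul_of_nonneg_left hexp hη.le]
  have hend' : ∀ q, 0 ≤ χ t₂ q + -η + κ * Real.exp ((c + 1) * V q) := by
    intro q
    rcases le_total (V q) R with hqR | hRq
    · have : η ≤ χ t₂ q := hq₀ hqR
      linarith [mul_pos hκ (Real.exp_pos ((c + 1) * V q))]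
    · have : η ≤ κ * Real.exp ((c + 1) * V q) := hκR.symm.trans_le (by gcongr)
      linarith [hend q]
  have hcomp := (hχ.add_const (-η)).add_barrier_nonneg hV hc hgrowth' h hκ hΛ₀ hΛ hstep hend'
    (left_mem_Icc.2 h.le) p
  have hsmall : barrier V κ (c + 1) Λ t₂ t₁ p < η :=
    calc barrier V κ (c + 1) Λ t₂ t₁ p ≤ κ * Real.exp (2 * (c + 1) * V p) := by
          unfold barrier
          gcongr
          · exact hV₀ p
          · linarith
      _ < κ * Real.exp ((c + 1) * R) := by
          refine mul_lt_mul_of_pos_left (Real.exp_lt_exp.2 ?_) hκ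
          simp only [R]
          linarith
      _ = η := hκR
  linarith

theorem forall_mem_Icc_of_short_steps {Q : ℝ → Prop} {t₁ t₂ δ : ℝ} (hδ : 0 < δ) (hend : Q t₂)
    (hstep : ∀ r₁ r₂, t₁ ≤ r₁ → r₁ < r₂ → r₂ ≤ t₂ → r₂ - r₁ ≤ δ → Q r₂ → Q r₁) :
    ∀ t ∈ Icc t₁ t₂, Q t := by
  have hsteps : ∀ N : ℕ, ∀ t ∈ Icc t₁ t₂, t₂ - t ≤ N * δ → Q t := by
    intro N
    induction N with
    | zero =>
      intro t ht hN
      rwa [le_antisymm ht.2 (by simpa using hN)]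
    | succ N ih =>
      intro t ht hN
      rcases ht.2.eq_or_lt with rfl | hlt
      · exact hend
      have hnext : t < min t₂ (t + δ) := lt_min hlt (by linarith)
      refine hstep t _ ht.1 hnext (min_le_left _ _) (by linarith [min_le_right t₂ (t + δ)])
        (ih _ ⟨ht.1.trans hnext.le, min_le_left _ _⟩ ?_)
      push_cast at hN
      rw [sub_le_comm, le_min_iff]
      exact ⟨by linarith [mul_nonneg N.cast_nonneg hδ.le], by linarith⟩
  intro t ht
  obtain ⟨N, hN⟩ := exists_nat_ge ((t₂ - t) / δ)
  exact hsteps N t ht ((div_le_iff₀ hδ).1 hN)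

theorem IsBackwardSupersolution.pos (hχ : IsBackwardSupersolution s b t₁ t₂ χ)
    (hV : IsLyapunov s b t₁ t₂ M V)
    (hgrowth : ∃ C c : ℝ, ∀ t ∈ Icc t₁ t₂, ∀ p, -(C * Real.exp (c * V p)) ≤ χ t p)
    (hend : ∀ p, 0 < χ t₂ p) {t : ℝ} (ht : t ∈ Icc t₁ t₂) (p : X) : 0 < χ t p := by
  obtain ⟨C, c, hgrowth⟩ := hgrowth
  have hgrowth' : ∀ t ∈ Icc t₁ t₂, ∀ p, -(|C| * Real.exp (|c| * V p)) ≤ χ t p := by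
    refine fun t ht p => le_trans (neg_le_neg ?_) (hgrowth t ht p)
    have := zero_le_one.trans (hV.one_le p)
    gcongr <;> exact le_abs_self _
  obtain ⟨Λ, hΛ⟩ := exists_gt (max 0 (M * (2 * (|c| + 1) + 2 * (|c| + 1) ^ 2)))
  obtain ⟨hΛ₀, hΛM⟩ := max_lt_iff.1 hΛ
  have hδ : 0 < (|c| + 1) / Λ := by positivity
  refine forall_mem_Icc_of_short_steps (Q := fun t => ∀ p, 0 < χ t p) hδ hend ?_ t ht p
  intro r₁ r₂ h₁ h h₂ hshort hpos
  exact (hχ.mono h₁ h₂).pos_of_short (hV.mono h₁ h₂) (abs_nonneg c)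
    (fun t ht => hgrowth' t (Icc_subset_Icc h₁ h₂ ht)) h hΛ₀.le hΛM
    ((le_div_iff₀' hΛ₀).1 hshort) hpos

end Barrier

section NoiseField

variable {n : ℕ} {ι Y : Type*} [NormedAddCommGroup Y] [NormedSpace ℝ Y]

/-- The `k`-th column of the diffusion matrix `σ`, as a vector field on the augmented state space
`ℝⁿ × Y` in which `Y` collects the variables that carry no noise. -/
def noiseField (σ : E n → Matrix (Fin n) ι ℝ) (k : ι) (p : E n × Y) : E n × Y :=
  (WithLp.toLp 2 ((σ p.1).col k), 0)

theorem sum_smul_single_eq_noiseField (σ : E n → Matrix (Fin n) ι ℝ) (k : ι) (p : E n × Y) :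
    ∑ i, σ p.1 i k • ((EuclideanSpace.single i 1, 0) : E n × Y) = noiseField σ k p := by
  ext i
  · simp [noiseField, Prod.fst_sum, Finset.sum_apply, Pi.single_apply]
  · simp [noiseField, Prod.snd_sum]

theorem sum_mul_transpose_apply {X κ : Type*} [NormedAddCommGroup X] [NormedSpace ℝ X]
    [Fintype ι] [Fintype κ] (B : X →L[ℝ] X →L[ℝ] ℝ) (σ : Matrix κ ι ℝ) (e : κ → X) :
    ∑ i, ∑ j, (σ * σ.transpose) i j * B (e i) (e j)
      = ∑ k, B (∑ i, σ i k • e i) (∑ i, σ i k • e i) := by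
  simp only [map_sum, map_smul, sum_apply, smul_apply, smul_eq_mul, Matrix.mul_apply,
    Matrix.transpose_apply, Finset.sum_mul, Finset.mul_sum]
  rw [Finset.sum_congr rfl fun i _ => Finset.sum_comm, Finset.sum_comm]
  refine Finset.sum_congr rfl fun k _ => ?_
  rw [Finset.sum_comm]
  exact Finset.sum_congr rfl fun i _ => Finset.sum_congr rfl fun j _ => by ring

theorem partialX_eq_lineDeriv (i : Fin n) (φ : E n × Y → ℝ) (c : Y) :
    partialX i (fun y => φ (y, c))
      = fun x => lineDeriv ℝ φ (x, c) (EuclideanSpace.single i 1, 0) := by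
  funext x
  simp [partialX, lineDeriv]

theorem Model.A_eq_sum_noiseField {d : ℕ} (P : Model n d) {φ : E n × Y → ℝ} {x : E n} {c : Y}
    (hφ : ContDiffAt ℝ 2 φ (x, c)) :
    P.A (fun y => φ (y, c)) x = -(1 / 2) * ∑ k,
      fderiv ℝ (fderiv ℝ φ) (x, c) (noiseField P.σ k (x, c)) (noiseField P.σ k (x, c)) := by
  have hpartial : ∀ i j, partialX i (partialX j fun y => φ (y, c)) x
      = fderiv ℝ (fderiv ℝ φ) (x, c) (EuclideanSpace.single i 1, 0)
        (EuclideanSpace.single j 1, 0) := by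
    intro i j
    rw [partialX_eq_lineDeriv, ← lineDeriv_lineDeriv_eq_fderiv_fderiv hφ]
    exact congrFun (partialX_eq_lineDeriv i
      (fun q => lineDeriv ℝ φ q (EuclideanSpace.single j 1, 0)) c) x
  simp only [Model.A, Model.a, hpartial, sum_mul_transpose_apply,
    ← sum_smul_single_eq_noiseField P.σ _ (x, c)]

theorem inner_gradient_eq_fderiv {φ : E n × Y → ℝ} {x : E n} {c : Y}
    (hφ : DifferentiableAt ℝ φ (x, c)) (v : E n) :
    inner ℝ (gradient (fun y => φ (y, c)) x) v = fderiv ℝ φ (x, c) (v, 0) := by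
  have hslice : HasFDerivAt (fun y => φ (y, c)) _ x :=
    HasFDerivAt.comp (g := φ) (f := fun y => (y, c)) x hφ.hasFDerivAt (hasFDerivAt_prodMk_left x c)
  rw [inner_gradient_left, hslice.fderiv]
  simp

end NoiseField

section ZDerivative

variable {n d : ℕ} {u : E n → ℝ → ℝ → ℝ} {x : E n} {z t : ℝ}

/-- A function of `x`, `z`, `t` as a function on the product space. -/
def joint (u : E n → ℝ → ℝ → ℝ) (q : E n × ℝ × ℝ) : ℝ :=
  u q.1 q.2.1 q.2.2

theorem Dz_eq_lineDeriv (u : E n → ℝ → ℝ → ℝ) (x : E n) (z t : ℝ) :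
    Dz u x z t = lineDeriv ℝ (joint u) (x, z, t) (0, 1, 0) := by
  have hshift := deriv_comp_const_add (fun ζ => u x ζ t) z 0
  rw [add_zero] at hshift
  simp [Dz, ← hshift, lineDeriv, joint]

theorem Dt_eq_lineDeriv (u : E n → ℝ → ℝ → ℝ) (x : E n) (z t : ℝ) :
    Dt u x z t = lineDeriv ℝ (joint u) (x, z, t) (0, 0, 1) := by
  have hshift := deriv_comp_const_add (fun s => u x z s) t 0
  rw [add_zero] at hshift
  simp [Dt, ← hshift, lineDeriv, joint]

theorem joint_Dz (u : E n → ℝ → ℝ → ℝ) :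
    joint (Dz u) = fun q => lineDeriv ℝ (joint u) q (0, 1, 0) :=
  funext fun q => Dz_eq_lineDeriv u q.1 q.2.1 q.2.2

theorem contDiffAt_joint_Dz (hu : ContDiffAt ℝ 3 (joint u) (x, z, t)) :
    ContDiffAt ℝ 2 (joint (Dz u)) (x, z, t) := by
  rw [joint_Dz]
  exact contDiffAt_lineDeriv hu (by norm_num) _

theorem hasDerivAt_z_of_hasLineDerivAt {ψ : E n × ℝ × ℝ → ℝ} {ψ' : ℝ}
    (h : HasLineDerivAt ℝ ψ ψ' (x, z, t) (0, 1, 0)) : HasDerivAt (fun ζ => ψ (x, ζ, t)) ψ' z := by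
  have hline : HasDerivAt (fun r => ψ (x, z + r, t)) ψ' 0 := by
    simpa [HasLineDerivAt] using h
  have hshift := HasDerivAt.comp_sub_const z z (by rwa [sub_self])
  exact hshift.congr_of_eventuallyEq (Eventually.of_forall fun ζ => by simp only [add_sub_cancel])

theorem eventually_z {Q : E n × ℝ × ℝ → Prop} (h : ∀ᶠ q in 𝓝 (x, z, t), Q q) :
    ∀ᶠ ζ in 𝓝 z, Q (x, ζ, t) :=
  (show ContinuousAt (fun ζ => (x, ζ, t)) z by fun_prop).eventually h

theorem hasDerivAt_Dt (hu : ContDiffAt ℝ 2 (joint u) (x, z, t)) :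
    HasDerivAt (fun ζ => Dt u x ζ t) (Dt (Dz u) x z t) z := by
  simp only [Dt_eq_lineDeriv, joint_Dz]
  exact hasDerivAt_z_of_hasLineDerivAt (hasLineDerivAt_lineDeriv hu (0, 0, 1) (0, 1, 0))

theorem hasDerivAt_Dz (hu : ContDiffAt ℝ 2 (joint u) (x, z, t)) :
    HasDerivAt (fun ζ => Dz u x ζ t) (Dz (Dz u) x z t) z := by
  simp only [Dz_eq_lineDeriv _ x, joint_Dz]
  exact hasDerivAt_z_of_hasLineDerivAt (hasLineDerivAt_lineDeriv hu (0, 1, 0) (0, 1, 0))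

theorem inner_Dx_eq_lineDeriv (hu : DifferentiableAt ℝ (joint u) (x, z, t)) (v : E n) :
    inner ℝ (Dx u x z t) v = lineDeriv ℝ (joint u) (x, z, t) (v, 0) :=
  (inner_gradient_eq_fderiv hu v).trans hu.lineDeriv_eq_fderiv.symm

theorem hasDerivAt_inner_Dx (hu : ContDiffAt ℝ 3 (joint u) (x, z, t)) (v : E n) :
    HasDerivAt (fun ζ => inner ℝ (Dx u x ζ t) v) (inner ℝ (Dx (Dz u) x z t) v) z := by
  have hev := eventually_z (hu.eventually (by simp))
  rw [inner_Dx_eq_lineDeriv ((contDiffAt_joint_Dz hu).differentiableAt two_ne_zero), joint_Dz]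
  refine (hasDerivAt_z_of_hasLineDerivAt (hasLineDerivAt_lineDeriv
    (hu.of_le (by norm_num)) (v, 0) (0, 1, 0))).congr_of_eventuallyEq ?_
  filter_upwards [hev] with ζ hζ
  exact inner_Dx_eq_lineDeriv (hζ.differentiableAt (by simp)) v

theorem hasDerivAt_A (P : Model n d) (hu : ContDiffAt ℝ 3 (joint u) (x, z, t)) :
    HasDerivAt (fun ζ => P.A (fun y => u y ζ t) x) (P.A (fun y => Dz u y z t) x) z := by
  set s : Fin n → E n × ℝ × ℝ := fun k => noiseField P.σ k (x, z, t)
  have hA : ∀ {w : E n → ℝ → ℝ → ℝ} {ζ : ℝ}, ContDiffAt ℝ 2 (joint w) (x, ζ, t) →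
      P.A (fun y => w y ζ t) x = -(1 / 2) * ∑ k,
        lineDeriv ℝ (fun q => lineDeriv ℝ (joint w) q (s k)) (x, ζ, t) (s k) := by
    intro w ζ hw
    simp only [lineDeriv_lineDeriv_eq_fderiv_fderiv hw]
    exact P.A_eq_sum_noiseField (φ := joint w) (c := (ζ, t)) hw
  have hsum : HasDerivAt
      (fun ζ => ∑ k, lineDeriv ℝ (fun q => lineDeriv ℝ (joint u) q (s k)) (x, ζ, t) (s k))
      (∑ k, lineDeriv ℝ (fun q => lineDeriv ℝ (joint (Dz u)) q (s k)) (x, z, t) (s k)) z := by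
    rw [joint_Dz]
    exact HasDerivAt.fun_sum fun k _ => hasDerivAt_z_of_hasLineDerivAt
      (hasLineDerivAt_lineDeriv_lineDeriv hu (s k) (s k) (0, 1, 0))
  have hev := eventually_z (Q := ContDiffAt ℝ 3 (joint u)) (hu.eventually (by simp))
  rw [hA (contDiffAt_joint_Dz hu)]
  exact (hsum.const_mul (-(1 / 2))).congr_of_eventuallyEq
    (hev.mono fun ζ hζ => hA (hζ.of_le (by norm_num)))

theorem hasDerivAt_preHam (P : Model n d) (hu : ContDiffAt ℝ 3 (joint u) (x, z, t)) (m' : L2 n)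
    (v : E d) :
    HasDerivAt (fun ζ => P.preHam x m' (Dx u x ζ t) (Dz u x ζ t) v)
      (P.preHam x m' (Dx (Dz u) x z t) (Dz (Dz u) x z t) v) z :=
  (hasDerivAt_inner_Dx hu _).add ((hasDerivAt_Dz (hu.of_le (by norm_num))).mul_const _)

end ZDerivative

section BackwardSolution

variable {n d : ℕ} {P : Model n d} {vstar : E n → L2 n → E n → ℝ → E d} {r : E n → ℝ}
  {k : E n → ℝ → ℝ} {u : E n → ℝ → ℝ → ℝ} {m : ℝ → L2 n} {t : ℝ}

/-- The backward half of the adjoint system for a prescribed flow `m`. The nonlocal terms enter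
only as a source `k x t` and a terminal correction `r x`, both independent of `z`. -/
structure IsBackwardSolution (P : Model n d) (vstar : E n → L2 n → E n → ℝ → E d) (r : E n → ℝ)
    (k : E n → ℝ → ℝ) (u : E n → ℝ → ℝ → ℝ) (m : ℝ → L2 n) : Prop where
  contDiffOn : ContDiffOn ℝ 3 (joint u) (univ ×ˢ univ ×ˢ Ioo 0 P.T)
  Dz_continuousOn : ContinuousOn (joint (Dz u)) (univ ×ˢ univ ×ˢ Icc 0 P.T)
  vstar_optimal : ∀ t ∈ Ioo 0 P.T, ∀ x z,
    IsMinOn (P.preHam x (m t) (Dx u x z t) (Dz u x z t)) univ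
      (vstar x (m t) (Dx u x z t) (Dz u x z t))
  terminal : ∀ x z, u x z P.T = Real.exp (P.α * (z + P.h x (m P.T))) + r x
  backward : ∀ t ∈ Ioo 0 P.T, ∀ x z, -Dt u x z t + P.A (fun y => u y z t) x
    = P.Htilde x (m t) (Dx u x z t) (Dz u x z t) + k x t

theorem IsAdjointSolution.isBackwardSolution {dh : E n → L2 n → E n → ℝ}
    {dH : E n → L2 n → E n → ℝ → E n → ℝ} {μ : ℝ → Measure (E n × ℝ)}
    (hu : IsAdjointSolution P vstar dh dH u μ m) :
    IsBackwardSolution P vstar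
      (fun x => P.α * ∫ p : E n × ℝ, Real.exp (P.α * (p.2 + P.h p.1 (m P.T)))
        * dh p.1 (m P.T) x ∂μ P.T)
      (fun x t => ∫ p : E n × ℝ, dH p.1 (m t) (Dx u p.1 p.2 t) (Dz u p.1 p.2 t) x ∂μ t) u m where
  contDiffOn := hu.u_contDiffOn
  Dz_continuousOn := hu.Dz_continuousOn
  vstar_optimal := hu.vstar_optimal
  terminal := hu.terminal
  backward := hu.backward

namespace IsBackwardSolution

theorem contDiffAt (hu : IsBackwardSolution P vstar r k u m) (ht : t ∈ Ioo 0 P.T) (x : E n)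
    (z : ℝ) : ContDiffAt ℝ 3 (joint u) (x, z, t) :=
  hu.contDiffOn.contDiffAt ((isOpen_univ.prod (isOpen_univ.prod isOpen_Ioo)).mem_nhds
    ⟨mem_univ x, mem_univ z, ht⟩)

theorem Dz_terminal (hu : IsBackwardSolution P vstar r k u m) (x : E n) (z : ℝ) :
    Dz u x z P.T = P.α * Real.exp (P.α * (z + P.h x (m P.T))) := by
  have hexponent : HasDerivAt (fun ζ : ℝ => P.α * (ζ + P.h x (m P.T))) (P.α * 1) z :=
    ((hasDerivAt_id z).add_const _).const_mul _
  simp only [Dz, hu.terminal]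
  rw [(hexponent.exp.add_const _).deriv, mul_one, mul_comm]

theorem Dz_equation (hu : IsBackwardSolution P vstar r k u m) (ht : t ∈ Ioo 0 P.T) (x : E n)
    (z : ℝ) :
    -Dt (Dz u) x z t + P.A (fun y => Dz u y z t) x
      = Dz (Dz u) x z t * P.loopF vstar u m x z t
        + inner ℝ (Dx (Dz u) x z t) (P.loopG vstar u m x z t) := by
  have hC := hu.contDiffAt ht x z
  have hHtilde : HasDerivAt (fun ζ => P.Htilde x (m t) (Dx u x ζ t) (Dz u x ζ t))
      (-Dt (Dz u) x z t + P.A (fun y => Dz u y z t) x) z := by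
    have hlhs := ((hasDerivAt_Dt (hC.of_le (by norm_num))).neg.add (hasDerivAt_A P hC)).sub_const
      (k x t)
    refine hlhs.congr_of_eventuallyEq (Eventually.of_forall fun ζ => ?_)
    exact eq_sub_of_add_eq (hu.backward t ht x ζ).symm
  have hbdd : ∀ ζ, BddBelow (range (P.preHam x (m t) (Dx u x ζ t) (Dz u x ζ t))) := fun ζ =>
    ⟨_, forall_mem_range.2 fun v => hu.vstar_optimal t ht x ζ (mem_univ v)⟩
  rw [hasDerivAt_iInf_eq_of_isMinOn (Eventually.of_forall hbdd) (hu.vstar_optimal t ht x z)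
    (hasDerivAt_preHam P hC (m t) _) hHtilde, add_comm]
  rfl

end IsBackwardSolution

end BackwardSolution

section Lyapunov

variable {H : Type*} [NormedAddCommGroup H]

/-- The Lyapunov function of the augmented state `(x, z)`: comparable with `1 + |x|² + |z|` and
smooth. -/
noncomputable def lyapunov (p : H × ℝ) : ℝ :=
  ‖p.1‖ ^ 2 / 2 + √(1 + p.2 ^ 2)

theorem one_le_lyapunov (p : H × ℝ) : 1 ≤ lyapunov p := by
  have : 1 ≤ √(1 + p.2 ^ 2) := Real.one_le_sqrt.2 (by linarith [sq_nonneg p.2])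
  unfold lyapunov
  linarith [sq_nonneg ‖p.1‖]

theorem norm_sq_add_abs_le_lyapunov (p : H × ℝ) : ‖p.1‖ ^ 2 + |p.2| ≤ 2 * lyapunov p := by
  have : |p.2| ≤ √(1 + p.2 ^ 2) := Real.abs_le_sqrt (by linarith)
  unfold lyapunov
  linarith [abs_nonneg p.2]

theorem exists_growth_lyapunov {S : Set ℝ} {χ : ℝ → H × ℝ → ℝ}
    (hχ : ∃ C c : ℝ, ∀ t ∈ S, ∀ p, -(C * Real.exp (c * (‖p.1‖ ^ 2 + |p.2|))) ≤ χ t p) :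
    ∃ C c : ℝ, ∀ t ∈ S, ∀ p, -(C * Real.exp (c * lyapunov p)) ≤ χ t p := by
  obtain ⟨C, c, hχ⟩ := hχ
  refine ⟨|C|, |c| * 2, fun t ht p => le_trans (neg_le_neg ?_) (hχ t ht p)⟩
  rw [mul_assoc]
  gcongr
  exacts [le_abs_self C, le_abs_self c, norm_sq_add_abs_le_lyapunov p]

variable [InnerProductSpace ℝ H]

theorem contDiff_lyapunov {k : WithTop ℕ∞} : ContDiff ℝ k (lyapunov (H := H)) :=
  ((contDiff_fst.norm_sq ℝ).div_const 2).add
    ((contDiff_const.add (contDiff_snd.pow 2)).sqrt fun p => by positivity)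

theorem isCompact_lyapunov_le [ProperSpace H] (R : ℝ) : IsCompact {p : H × ℝ | lyapunov p ≤ R} := by
  refine Metric.isCompact_of_isClosed_isBounded
    (isClosed_le (contDiff_lyapunov (k := 0)).continuous continuous_const)
    (isBounded_iff_forall_norm_le.2 ⟨2 * R + 1, fun p hp => ?_⟩)
  have hR : ‖p.1‖ ^ 2 + |p.2| ≤ 2 * R :=
    (norm_sq_add_abs_le_lyapunov p).trans (mul_le_mul_of_nonneg_left hp zero_le_two)
  refine norm_prod_le_iff.2 ⟨?_, ?_⟩
  · linarith [sq_nonneg (‖p.1‖ - 1 / 2), abs_nonneg p.2]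
  · rw [Real.norm_eq_abs]
    linarith [sq_nonneg ‖p.1‖]

theorem fderiv_lyapunov_apply (p w : H × ℝ) :
    fderiv ℝ lyapunov p w = inner ℝ p.1 w.1 + p.2 / √(1 + p.2 ^ 2) * w.2 := by
  have hx : HasFDerivAt (fun q : H × ℝ => ‖q.1‖ ^ 2) _ p := hasFDerivAt_fst.norm_sq
  have hz : HasDerivAt (fun ζ : ℝ => √(1 + ζ ^ 2)) (p.2 / √(1 + p.2 ^ 2)) p.2 := by
    have hpow : HasDerivAt (fun ζ : ℝ => 1 + ζ ^ 2) (2 * p.2) p.2 := by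
      simpa using (hasDerivAt_pow 2 p.2).const_add 1
    exact (hpow.sqrt (by positivity)).congr_deriv (mul_div_mul_left _ _ two_ne_zero)
  have hsum := (hx.mul_const 2⁻¹).add (hz.comp_hasFDerivAt p hasFDerivAt_snd)
  have hV : HasFDerivAt lyapunov _ p := hsum
  rw [hV.fderiv]
  simp

theorem fderiv_fderiv_lyapunov_fst (p : H × ℝ) (v : H) :
    fderiv ℝ (fderiv ℝ lyapunov) p (v, 0) (v, 0) = ‖v‖ ^ 2 := by
  have hfst : (fun q : H × ℝ => lineDeriv ℝ lyapunov q (v, 0)) = fun q => inner ℝ q.1 v := by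
    funext q
    rw [((contDiff_lyapunov (k := 1)).differentiable one_ne_zero q).lineDeriv_eq_fderiv,
      fderiv_lyapunov_apply, mul_zero, add_zero]
  rw [← lineDeriv_lineDeriv_eq_fderiv_fderiv contDiff_lyapunov.contDiffAt, hfst, lineDeriv]
  simp [inner_add_left, inner_smul_left]

variable {n : ℕ} {ι : Type*} [Fintype ι] {σ : E n → Matrix (Fin n) ι ℝ}

theorem sum_norm_sq_noiseField_le {Y : Type*} [NormedAddCommGroup Y] {K : ℝ}
    (hσ : ∀ x i k, |σ x i k| ≤ K) (p : E n × Y) :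
    ∑ k, ‖(noiseField σ k p).1‖ ^ 2 ≤ Fintype.card ι * (n * K ^ 2) := by
  have hcol : ∀ k, ‖(noiseField σ k p).1‖ ^ 2 ≤ n * K ^ 2 := fun k =>
    calc ‖(noiseField σ k p).1‖ ^ 2 = ∑ i, |σ p.1 i k| ^ 2 := EuclideanSpace.norm_sq_eq _
      _ ≤ ∑ _i : Fin n, K ^ 2 := by gcongr with i; exact hσ p.1 i k
      _ = n * K ^ 2 := by simp
  simpa using Finset.sum_le_sum fun k (_ : k ∈ Finset.univ) => hcol k

theorem diffusionGenerator_noiseField_lyapunov (b : E n × ℝ → E n × ℝ) (p : E n × ℝ) :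
    diffusionGenerator (noiseField σ) b lyapunov p = 1 / 2 * ∑ k, ‖(noiseField σ k p).1‖ ^ 2
      + (inner ℝ p.1 (b p).1 + p.2 / √(1 + p.2 ^ 2) * (b p).2) := by
  simp only [diffusionGenerator, fderiv_lyapunov_apply, noiseField, fderiv_fderiv_lyapunov_fst]

theorem carreDuChamp_noiseField_lyapunov_le (p : E n × ℝ) :
    carreDuChamp (noiseField σ) lyapunov p ≤ ‖p.1‖ ^ 2 * ∑ k, ‖(noiseField σ k p).1‖ ^ 2 := by
  rw [carreDuChamp, Finset.mul_sum]
  refine Finset.sum_le_sum fun k _ => ?_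
  rw [fderiv_lyapunov_apply, ← mul_pow]
  simpa [noiseField] using sq_le_sq' (neg_le_of_abs_le (abs_real_inner_le_norm p.1 _))
    (real_inner_le_norm p.1 (noiseField σ k p).1)

theorem isLyapunov_lyapunov {b : ℝ → E n × ℝ → E n × ℝ} {t₁ t₂ K₁ K₂ : ℝ}
    (hσ : ∀ x i k, |σ x i k| ≤ K₁)
    (hb : ∀ t ∈ Ioo t₁ t₂, ∀ p, inner ℝ p.1 (b t p).1 + p.2 / √(1 + p.2 ^ 2) * (b t p).2
      ≤ K₂ * (1 + ‖p.1‖ ^ 2 + |p.2|)) :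
    IsLyapunov (fun _ => noiseField σ) b t₁ t₂
      (2 * (Fintype.card ι * (n * K₁ ^ 2)) + 3 * |K₂|) lyapunov where
  contDiff := contDiff_lyapunov
  one_le := one_le_lyapunov
  isCompact_le := isCompact_lyapunov_le
  generator_le t ht p := by
    have hnoise := sum_norm_sq_noiseField_le hσ p
    set N : ℝ := Fintype.card ι * (n * K₁ ^ 2)
    have hN : 0 ≤ N := by positivity
    have hV := one_le_lyapunov p
    have hdrift : K₂ * (1 + ‖p.1‖ ^ 2 + |p.2|) ≤ |K₂| * (3 * lyapunov p) := by
      gcongr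
      · exact le_abs_self K₂
      · linarith [norm_sq_add_abs_le_lyapunov p]
    rw [diffusionGenerator_noiseField_lyapunov]
    linarith [hb t ht p, mul_le_mul_of_nonneg_left hV hN]
  carreDuChamp_le t _ p := by
    have hx : ‖p.1‖ ^ 2 ≤ 2 * lyapunov p := by
      linarith [norm_sq_add_abs_le_lyapunov p, abs_nonneg p.2]
    have hV : 0 ≤ lyapunov p := zero_le_one.trans (one_le_lyapunov p)
    calc carreDuChamp (noiseField σ) lyapunov p
        ≤ ‖p.1‖ ^ 2 * ∑ k, ‖(noiseField σ k p).1‖ ^ 2 := carreDuChamp_noiseField_lyapunov_le p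
      _ ≤ 2 * lyapunov p * (Fintype.card ι * (n * K₁ ^ 2)) := by
        gcongr
        exact sum_norm_sq_noiseField_le hσ p
      _ ≤ (2 * (Fintype.card ι * (n * K₁ ^ 2)) + 3 * |K₂|) * lyapunov p := by
        linarith [mul_nonneg (abs_nonneg K₂) hV]

end Lyapunov

section ClosedLoop

variable {n d : ℕ} {P : Model n d} {vstar : E n → L2 n → E n → ℝ → E d} {r : E n → ℝ}
  {k : E n → ℝ → ℝ} {u : E n → ℝ → ℝ → ℝ} {m : ℝ → L2 n}

/-- The drift of the augmented state `(x, z)` at time `t` under the optimal feedback. -/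
noncomputable def Model.closedLoopDrift (P : Model n d) (vstar : E n → L2 n → E n → ℝ → E d)
    (u : E n → ℝ → ℝ → ℝ) (m : ℝ → L2 n) (t : ℝ) (p : E n × ℝ) : E n × ℝ :=
  (P.loopG vstar u m p.1 p.2 t, P.loopF vstar u m p.1 p.2 t)

theorem Model.generator_eq_diffusionGenerator {φ : E n × ℝ → ℝ} {p : E n × ℝ}
    (hφ : ContDiffAt ℝ 2 φ p) (t : ℝ) :
    P.generator vstar u m t φ p
      = diffusionGenerator (noiseField P.σ) (P.closedLoopDrift vstar u m t) φ p := by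
  obtain ⟨x, z⟩ := p
  have hd := hφ.differentiableAt two_ne_zero
  have hz : deriv (fun ζ => φ (x, ζ)) z = fderiv ℝ φ (x, z) (0, 1) :=
    (hd.hasFDerivAt.comp_hasDerivAt z
      ((hasDerivAt_const z x).prodMk (hasDerivAt_id z))).deriv
  have hdrift : P.closedLoopDrift vstar u m t (x, z)
      = (P.loopG vstar u m x z t, 0) + P.loopF vstar u m x z t • ((0, 1) : E n × ℝ) := by
    simp [Model.closedLoopDrift]
  rw [Model.generator, diffusionGenerator, P.A_eq_sum_noiseField hφ, inner_gradient_eq_fderiv hd,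
    hz, hdrift, map_add, map_smul, smul_eq_mul]
  ring

theorem IsBackwardSolution.isBackwardSupersolution_Dz
    (hu : IsBackwardSolution P vstar r k u m) :
    IsBackwardSupersolution (fun _ => noiseField P.σ) (P.closedLoopDrift vstar u m) 0 P.T
      fun t p => Dz u p.1 p.2 t := by
  have hslab : ∀ t ∈ Ioo 0 P.T, ∀ p : E n × ℝ,
      ContDiffAt ℝ 2 (joint (Dz u)) (p.1, p.2, t) := fun t ht p =>
    contDiffAt_joint_Dz (hu.contDiffAt ht p.1 p.2)
  have hspace : ∀ t ∈ Ioo 0 P.T, ContDiff ℝ 2 fun p : E n × ℝ => Dz u p.1 p.2 t :=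
    fun t ht => contDiff_iff_contDiffAt.2 fun p =>
      (hslab t ht p).comp (f := fun p : E n × ℝ => (p.1, p.2, t)) p (by fun_prop)
  refine ⟨⟨?_, fun t ht p => ?_, hspace⟩, fun t ht p => le_of_eq ?_⟩
  · exact hu.Dz_continuousOn.comp (f := fun q : ℝ × E n × ℝ => (q.2.1, q.2.2, q.1))
      (by fun_prop) fun q hq => ⟨mem_univ _, mem_univ _, hq.1⟩
  · exact ((hslab t ht p).differentiableAt two_ne_zero).comp (f := fun s => (p.1, p.2, s)) t
      (by fun_prop)
  · rw [backwardOperator, ← Model.generator_eq_diffusionGenerator (hspace t ht).contDiffAt]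
    have heq := hu.Dz_equation ht p.1 p.2
    simp only [Model.generator]
    simp only [Dt, Dx, Dz] at heq ⊢
    linarith

end ClosedLoop

end RiskSensitive

theorem lemma1_general {n d : ℕ} (P : RiskSensitive.Model n d) (hα : 0 < P.α)
    (vstar : RiskSensitive.E n → RiskSensitive.L2 n → RiskSensitive.E n → ℝ → RiskSensitive.E d)
    (r : RiskSensitive.E n → ℝ) (k : RiskSensitive.E n → ℝ → ℝ)
    (u : RiskSensitive.E n → ℝ → ℝ → ℝ) (m : ℝ → RiskSensitive.L2 n)
    (hu : RiskSensitive.IsBackwardSolution P vstar r k u m)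
    (χ : RiskSensitive.E n → ℝ → ℝ → ℝ) (hχ : χ = RiskSensitive.Dz u)
    (hσ : ∃ K : ℝ, ∀ x i j, |P.σ x i j| ≤ K)
    (hdrift : ∃ K : ℝ, ∀ t ∈ Set.Ioo 0 P.T, ∀ x z,
      inner ℝ x (P.loopG vstar u m x z t) + z / √(1 + z ^ 2) * P.loopF vstar u m x z t
        ≤ K * (1 + ‖x‖ ^ 2 + |z|))
    (hgrowth : ∃ C c : ℝ, ∀ t ∈ Set.Icc 0 P.T, ∀ x z,
      -(C * Real.exp (c * (‖x‖ ^ 2 + |z|))) ≤ χ x z t) :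
    (∀ x z, χ x z P.T = P.α * Real.exp (P.α * (z + P.h x (m P.T)))) ∧
    (∀ t ∈ Set.Ioo 0 P.T, ∀ x z,
      -RiskSensitive.Dt χ x z t + P.A (fun y => χ y z t) x
        = RiskSensitive.Dz χ x z t * P.loopF vstar u m x z t
          + inner ℝ (RiskSensitive.Dx χ x z t) (P.loopG vstar u m x z t)) ∧
    (∀ t ∈ Set.Icc 0 P.T, ∀ x z, 0 < χ x z t) := by
  subst hχ
  refine ⟨hu.Dz_terminal, fun t ht => hu.Dz_equation ht, fun t ht x z => ?_⟩
  obtain ⟨K₁, hσ⟩ := hσ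
  obtain ⟨K₂, hdrift⟩ := hdrift
  obtain ⟨C, c, hgrowth⟩ := hgrowth
  have hlyapunov := RiskSensitive.isLyapunov_lyapunov (b := P.closedLoopDrift vstar u m) hσ
    fun t ht p => hdrift t ht p.1 p.2
  have hlower := RiskSensitive.exists_growth_lyapunov
    (χ := fun t p => RiskSensitive.Dz u p.1 p.2 t) ⟨C, c, fun t ht p => hgrowth t ht p.1 p.2⟩
  have hterminal : ∀ p : RiskSensitive.E n × ℝ, 0 < RiskSensitive.Dz u p.1 p.2 P.T := fun p => by
    rw [hu.Dz_terminal]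
    positivity
  exact hu.isBackwardSupersolution_Dz.pos hlyapunov hlower hterminal ht (x, z)

theorem lemma1 {n d : ℕ} (P : RiskSensitive.Model n d)
    (hα : 0 < P.α) (hT : 0 < P.T) (hm₀ : RiskSensitive.IsProbDensity P.m₀)
    (vstar : RiskSensitive.E n → RiskSensitive.L2 n → RiskSensitive.E n → ℝ → RiskSensitive.E d)
    (dh : RiskSensitive.E n → RiskSensitive.L2 n → RiskSensitive.E n → ℝ)
    (dH : RiskSensitive.E n → RiskSensitive.L2 n → RiskSensitive.E n → ℝ →
      RiskSensitive.E n → ℝ)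
    (u : RiskSensitive.E n → ℝ → ℝ → ℝ)
    (μ : ℝ → MeasureTheory.Measure (RiskSensitive.E n × ℝ))
    (m : ℝ → RiskSensitive.L2 n)
    (hu : RiskSensitive.IsAdjointSolution P vstar dh dH u μ m)
    (χ : RiskSensitive.E n → ℝ → ℝ → ℝ) (hχ : χ = RiskSensitive.Dz u)
    -- growth hypotheses: bounded diffusion coefficient, one-sided growth of the closed-loop drift,
    -- and at most Gaussian (in `x`) and exponential (in `z`) growth of the negative part of `χ`
    (hσ : ∃ K : ℝ, ∀ x i j, |P.σ x i j| ≤ K)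
    (hdrift : ∃ K : ℝ, ∀ t ∈ Set.Ioo 0 P.T, ∀ x z,
      inner ℝ x (P.loopG vstar u m x z t) + z / √(1 + z ^ 2) * P.loopF vstar u m x z t
        ≤ K * (1 + ‖x‖ ^ 2 + |z|))
    (hgrowth : ∃ C c : ℝ, ∀ t ∈ Set.Icc 0 P.T, ∀ x z,
      -(C * Real.exp (c * (‖x‖ ^ 2 + |z|))) ≤ χ x z t) :
    (∀ x z, χ x z P.T = P.α * Real.exp (P.α * (z + P.h x (m P.T)))) ∧
    (∀ t ∈ Set.Ioo 0 P.T, ∀ x z,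
      -RiskSensitive.Dt χ x z t + P.A (fun y => χ y z t) x
        = RiskSensitive.Dz χ x z t * P.loopF vstar u m x z t
          + inner ℝ (RiskSensitive.Dx χ x z t) (P.loopG vstar u m x z t)) ∧
    (∀ t ∈ Set.Icc 0 P.T, ∀ x z, 0 < χ x z t) := by
  exact lemma1_general P hα vstar _ _ u m hu.isBackwardSolution χ hχ hσ hdrift hgrowth
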